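/- Covers and selection. A family $\mathcal U$ of subsets of a topological space $X$ is a cover of $X$ if $X=\bigcup\mathcal U$ and $X\notin\mathcal U$. Let $\mathrm O(X)$ be the family of countable open covers of $X$, and let $\Gamma(X)$ be the family of infinite $\mathcal U\in\mathrm O(X)$ such that each point of $X$ belongs to all but finitely many members of $\mathcal U$. The space $X$ is *Menger* ($\mathsf S_{fin}(\mathrm O,\mathrm O)$) if for all $\mathcal U_0,\mathcal U_1,\ldots\in\mathrm O(X)$ there are finite $\mathcal F_n\subseteq\mathcal U_n$ with $\bigcup_n\mathcal F_n\in\mathrm O(X)$. The space $X$ is *Hurewicz* ($\mathsf U_{fin}(\mathrm O,\Gamma)$) if it is Lindelöf and, for all $\mathcal U_0,\mathcal U_1,\ldots\in\mathrm O(X)$ none of which contains a finite subcover, there are finite $\mathcal F_n\subseteq\mathcal U_n$ with $\{\bigcup\mathcal F_n : n\in\mathbb N\}\in\Gamma(X)$. Let $(\mathrm{Hurewicz},\mathrm{Menger})^\times$ be the class of all spaces $X$ such that $X\times Y$ is Menger for every Hurewicz space $Y$. Concentration. For a cardinal $\lambda$, $K_\lambda$ is the class of spaces that are unions of fewer than $\lambda$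 compact subspaces. A space $X$ is *$K_\lambda$-concentrated* if there is a $\sigma$-compact set $D\subseteq X$ such that $X\setminus U\in K_\lambda$ for every open $U\supseteq D$. Let $\mathfrak d$ be the dominating number, that is, the least cardinality of a set $D\subseteq\mathbb N^{\mathbb N}$ such that for every $f\in\mathbb N^{\mathbb N}$ there is $g\in D$ with $f(n)\le g(n)$ for all but finitely many $n$. **Theorem.** 1. Let $\lambda$ be a regular uncountable cardinal with $\lambda\le\mathfrak d$. The minimal number of $K_\lambda$-concentrated spaces whose union is a regular space not in $(\mathrm{Hurewicz},\mathrm{Menger})^\times$ is $\mathfrak d$. 2. The minimal number of $K_{\mathfrak d}$-concentrated spaces whose union is a regular space not in $(\mathrm{Hurewicz},\mathrm{Menger})^\times$ is $\operatorname{cf}(\mathfrak d)$. (The spaces forming the union carry the subspace topology of the union.) -/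

import Mathlib

open Set Filter Topology
open scoped Cardinal

universe u

namespace Selection

/-- The countable open covers of `X`; a cover must not have the whole space as a member. -/
def Op (X : Type u) [TopologicalSpace X] : Set (Set (Set X)) :=
  {𝒰 | 𝒰.Countable ∧ (∀ U ∈ 𝒰, IsOpen U) ∧ ⋃₀ 𝒰 = univ ∧ univ ∉ 𝒰}

/-- The infinite countable open covers of `X` such that every point belongs to all but finitely
many members. -/
def Ga (X : Type u) [TopologicalSpace X] : Set (Set (Set X)) :=
  {𝒰 | 𝒰 ∈ Op X ∧ 𝒰.Infinite ∧ ∀ x, {U ∈ 𝒰 | x ∉ U}.Finite}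

/-- The selection principle `S_fin(𝒜, ℬ)`. -/
def Sfin {X : Type u} (𝒜 ℬ : Set (Set (Set X))) : Prop :=
  ∀ 𝒰 : ℕ → Set (Set X), (∀ n, 𝒰 n ∈ 𝒜) →
    ∃ F : ℕ → Set (Set X), (∀ n, F n ⊆ 𝒰 n ∧ (F n).Finite) ∧ (⋃ n, F n) ∈ ℬ

/-- The selection principle `U_fin(𝒜, ℬ)`. -/
def Ufin {X : Type u} (𝒜 ℬ : Set (Set (Set X))) : Prop :=
  ∀ 𝒰 : ℕ → Set (Set X), (∀ n, 𝒰 n ∈ 𝒜) →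
    (∀ n, ¬ ∃ F ⊆ 𝒰 n, F.Finite ∧ ⋃₀ F = univ) →
    ∃ F : ℕ → Set (Set X), (∀ n, F n ⊆ 𝒰 n ∧ (F n).Finite) ∧
      range (fun n => ⋃₀ F n) ∈ ℬ

/-- Menger's property `S_fin(O, O)`. -/
def IsMenger (X : Type u) [TopologicalSpace X] : Prop :=
  Sfin (Op X) (Op X)

/-- Hurewicz's property `U_fin(O, Γ)`, for Lindelöf spaces. As covers in `Op` are countable, the
Lindelöf condition makes this the usual Hurewicz property, about arbitrary open covers. -/
def IsHurewicz (X : Type u) [TopologicalSpace X] : Prop :=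
  LindelofSpace X ∧ Ufin (Op X) (Ga X)

/-- The class of spaces whose product with every member of `P` is in `Q`. -/
def Productive (P Q : ∀ (X : Type u) [TopologicalSpace X], Prop)
    (X : Type u) [TopologicalSpace X] : Prop :=
  ∀ (Y : Type u) [TopologicalSpace Y], P Y → Q (X × Y)

/-- The subspace `A` belongs to `K_lam`: it is a union of fewer than `lam` compact sets. -/
def IsKUnion {X : Type u} [TopologicalSpace X] (lam : Cardinal.{u}) (A : Set X) : Prop :=
  ∃ S : Set (Set X), #S < lam ∧ (∀ K ∈ S, IsCompact K) ∧ ⋃₀ S = A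

/-- `X` is `K_lam`-concentrated: some σ-compact `D ⊆ X` is such that `X \ U` is in `K_lam` for
every open `U ⊇ D`. -/
def IsKConcentrated (lam : Cardinal.{u}) (X : Type u) [TopologicalSpace X] : Prop :=
  ∃ D : Set X, IsSigmaCompact D ∧ ∀ U : Set X, IsOpen U → D ⊆ U → IsKUnion lam Uᶜ

/-- The cardinals `κ` such that some regular space that is a union of `κ` many
`K_lam`-concentrated subspaces has a non-Menger product with some Hurewicz space. -/
def unionNumbers (lam : Cardinal.{u}) : Set Cardinal.{u} :=
  {κ | ∃ (X : Type u) (_ : TopologicalSpace X) (ι : Type u) (A : ι → Set X),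
    #ι = κ ∧ (∀ i, IsKConcentrated lam (A i)) ∧ (⋃ i, A i) = univ ∧ RegularSpace X ∧
      ¬ Productive IsHurewicz IsMenger X}

/-- The dominating number `𝔡`: the least cardinality of a subset of `ℕ → ℕ` that is cofinal
with respect to eventual domination. -/
noncomputable def dominatingNumber : Cardinal.{0} :=
  sInf {κ | ∃ D : Set (ℕ → ℕ), #D = κ ∧ ∀ f : ℕ → ℕ, ∃ g ∈ D, ∀ᶠ n in atTop, f n ≤ g n}

end Selection

namespace Selection

/-! Lower bounds (`productive_of_iUnion`): for compact sets `K n` and a Hurewicz factor,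
`IsHurewicz.exists_tubes` gives one function `f` and open `W n ⊇ K n` such that each `W n × {y}` is
eventually inside `U n (f n)`. Fewer than 𝔡 such functions leave some `g` undominated. Applied to
compact sets exhausting the cores `D i`, this captures everything except complements of open sets
around the cores. By concentration these are unions of few compact sets; if fewer than 𝔡 in total, a
second undominated function captures them too.

Upper bounds: a subspace of `ℕ → ℕ` of size 𝔡 that dominates everywhere is not Menger. It splits
into 𝔡 singletons, or into cf 𝔡 sets of size below 𝔡, all concentrated on the empty set. -/

theorem exists_sUnion_subset_of_finite {Z : Type*} {V : ℕ → Set Z} (hV : Monotone V)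
    {F : Set (Set Z)} (hF : F ⊆ range V) (hFf : F.Finite) : ∃ m, ⋃₀ F ⊆ V m := by
  induction F, hFf using Set.Finite.induction_on with
  | empty => exact ⟨0, by simp⟩
  | @insert A F _ _ ih =>
    obtain ⟨⟨a, rfl⟩, hF'⟩ := insert_subset_iff.1 hF
    obtain ⟨m, hm⟩ := ih hF'
    refine ⟨max a m, ?_⟩
    rw [sUnion_insert]
    exact union_subset (hV (le_max_left _ _)) (hm.trans (hV (le_max_right _ _)))

/-! ### Selection and tubes from the Hurewicz property -/

/-- In a Hurewicz space, one member can be selected from each of a sequence of increasing open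
covers so that every point belongs to all but finitely many selected sets. -/
theorem IsHurewicz.exists_eventually_mem {Y : Type u} [TopologicalSpace Y] (hY : IsHurewicz Y)
    {V : ℕ → ℕ → Set Y} (ho : ∀ n m, IsOpen (V n m)) (hm : ∀ n, Monotone (V n))
    (hc : ∀ n y, ∃ m, y ∈ V n m) : ∃ f : ℕ → ℕ, ∀ y, ∀ᶠ n in atTop, y ∈ V n (f n) := by
  classical
  -- Making the covers decrease in `n` lets a selection from a later cover serve an earlier one, and
  -- once one cover lacks a finite subcover, so do all later ones.
  set W : ℕ → ℕ → Set Y := fun n m => ⋂ k ∈ Iic n, V k m with hW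
  have hWo : ∀ n m, IsOpen (W n m) := fun n m =>
    (finite_Iic n).isOpen_biInter fun k _ => ho k m
  have hWm : ∀ n, Monotone (W n) := fun n a b hab =>
    iInter₂_mono fun k _ => hm k hab
  have hWV : ∀ k n m, k ≤ n → W n m ⊆ V k m := fun k n m h => biInter_subset_of_mem h
  have hWanti : ∀ k n m, k ≤ n → W n m ⊆ W k m := fun k n m h =>
    biInter_subset_biInter_left (Iic_subset_Iic.2 h)
  have hWc : ∀ n y, ∃ m, y ∈ W n m := by
    intro n y
    choose g hg using fun k => hc k y
    refine ⟨(Finset.Iic n).sup g, mem_iInter₂.2 fun k hk => ?_⟩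
    exact hm k (Finset.le_sup (f := g) (Finset.mem_Iic.2 hk)) (hg k)
  by_cases h : ∀ n, ∃ m, W n m = univ
  · choose f hf using h
    exact ⟨f, fun y => Eventually.of_forall fun n => hWV n n _ le_rfl (hf n ▸ mem_univ y)⟩
  push Not at h
  obtain ⟨N, hN⟩ := h
  have hne : ∀ n m, W (N + n) m ≠ univ := fun n m h =>
    hN m (univ_subset_iff.1 (h ▸ hWanti N (N + n) m (Nat.le_add_right _ _)))
  obtain ⟨F, hF, hG⟩ := hY.2 (fun n => range (W (N + n)))
    (fun n => ⟨countable_range _, by rintro _ ⟨m, rfl⟩; exact hWo _ _,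
      eq_univ_of_forall fun y => by
        obtain ⟨m, hm⟩ := hWc (N + n) y
        exact ⟨_, ⟨m, rfl⟩, hm⟩,
      by rintro ⟨m, hm⟩; exact hne n m hm⟩)
    (fun n => by
      rintro ⟨F, hF, hFf, hFu⟩
      obtain ⟨m, hm⟩ := exists_sUnion_subset_of_finite (hWm (N + n)) hF hFf
      exact hne n m (univ_subset_iff.1 (hFu ▸ hm)))
  obtain ⟨-, hinf, hpt⟩ := hG
  choose g hg using fun n => exists_sUnion_subset_of_finite (hWm (N + n)) (hF n).1 (hF n).2
  set G : ℕ → Set Y := fun n => ⋃₀ F n with hGdef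
  have hinf' : Infinite (range G) := hinf.to_subtype
  -- `Ga` counts distinct sets, but `G` may repeat. Keeping one index per value turns finitely many
  -- bad sets into finitely many bad indices; `n ≤ q n` then allows passing back to `V n`.
  have hS : (range (rangeSplitting G)).Infinite := infinite_range_of_injective
    (rangeSplitting_injective G)
  have : Infinite (range (rangeSplitting G)) := hS.to_subtype
  set q := Nat.orderEmbeddingOfSet (range (rangeSplitting G))
  have hqS : ∀ n, q n ∈ range (rangeSplitting G) := fun n => by
    rw [← Nat.orderEmbeddingOfSet_range (range (rangeSplitting G))]
    exact mem_range_self n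
  have hGq : Function.Injective (fun n => G (q n)) := by
    intro a b hab
    obtain ⟨s, hs⟩ := hqS a
    obtain ⟨t, ht⟩ := hqS b
    apply q.injective
    simp only [← hs, ← ht, apply_rangeSplitting] at hab
    rw [← hs, ← ht, Subtype.ext hab]
  refine ⟨fun n => g (q n), fun y => ?_⟩
  have hfy : {n | y ∉ G (q n)}.Finite := by
    refine ((hpt y).preimage (f := fun n => G (q n)) hGq.injOn).subset ?_
    intro n hn
    exact ⟨⟨q n, rfl⟩, hn⟩
  rw [← Nat.cofinite_eq_atTop]
  filter_upwards [hfy.compl_mem_cofinite] with n hn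
  have hn' : y ∈ G (q n) := by
    by_contra h
    exact hn h
  exact hWV n _ _ ((q.strictMono.le_apply).trans (Nat.le_add_left _ _)) (hg _ hn')

/-- A sequence of compact sets, multiplied by a Hurewicz space, can be captured by tubes around
the compact sets. -/
theorem IsHurewicz.exists_tubes {X Y : Type*} [TopologicalSpace X] [TopologicalSpace Y]
    (hY : IsHurewicz Y) {U : ℕ → ℕ → Set (X × Y)} (ho : ∀ n m, IsOpen (U n m))
    (hm : ∀ n, Monotone (U n)) (hc : ∀ n p, ∃ m, p ∈ U n m) {K : ℕ → Set X}
    (hK : ∀ n, IsCompact (K n)) :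
    ∃ (f : ℕ → ℕ) (W : ℕ → Set X), (∀ n, IsOpen (W n)) ∧ (∀ n, K n ⊆ W n) ∧
      ∀ y, ∀ᶠ n in atTop, ∀ x ∈ W n, (x, y) ∈ U n (f n) := by
  have := hY.1
  rcases isEmpty_or_nonempty Y with hE | hE
  · exact ⟨0, fun _ => univ, fun _ => isOpen_univ, fun _ => subset_univ _, fun y => hE.elim y⟩
  have tube : ∀ n y, ∃ (m : ℕ) (W : Set X) (V : Set Y), IsOpen W ∧ IsOpen V ∧ K n ⊆ W ∧ y ∈ V ∧
      W ×ˢ V ⊆ U n m := by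
    intro n y
    obtain ⟨m, hKm⟩ := ((hK n).prod isCompact_singleton).elim_directed_cover (U n) (ho n)
      (fun p _ => mem_iUnion.2 (hc n p)) (hm n).directed_le
    obtain ⟨W, V, hW, hV, hKW, hyV, hWV⟩ :=
      generalized_tube_lemma (hK n) (isCompact_singleton (x := y)) (ho n m) hKm
    exact ⟨m, W, V, hW, hV, hKW, hyV rfl, hWV⟩
  choose m W V hW hV hKW hyV hWV using tube
  have hcov : ∀ n, ∃ e : ℕ → Y, ∀ z, ∃ j, z ∈ V n (e j) := by
    intro n
    obtain ⟨t, ht, htu⟩ := LindelofSpace.elim_nhds_subcover (V n)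
      fun y => (hV n y).mem_nhds (hyV n y)
    have htne : t.Nonempty := by
      by_contra h
      rw [not_nonempty_iff_eq_empty] at h
      subst h
      have := htu ▸ mem_univ hE.some
      simp at this
    obtain ⟨e, rfl⟩ := ht.exists_eq_range htne
    refine ⟨e, fun z => ?_⟩
    have hz : z ∈ ⋃ x ∈ range e, V n x := htu ▸ mem_univ z
    simpa using hz
  choose e he using hcov
  obtain ⟨h, hh⟩ := hY.exists_eventually_mem (V := fun n k => ⋃ j ∈ Iic k, V n (e n j))
    (fun n k => isOpen_biUnion fun j _ => hV _ _)
    (fun n a b hab => biUnion_subset_biUnion_left (Iic_subset_Iic.2 hab))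
    (fun n y => by
      obtain ⟨j, hj⟩ := he n y
      exact ⟨j, mem_biUnion (mem_Iic.2 le_rfl) hj⟩)
  -- Only the first `h n + 1` boxes are used at stage `n`, so intersecting their `X`-sides stays
  -- open.
  refine ⟨fun n => (Finset.Iic (h n)).sup fun j => m n (e n j),
    fun n => ⋂ j ∈ Iic (h n), W n (e n j),
    fun n => (finite_Iic _).isOpen_biInter fun j _ => hW _ _,
    fun n => subset_iInter₂ fun j _ => hKW _ _, fun y => ?_⟩
  filter_upwards [hh y] with n hn x hx
  obtain ⟨j, hj, hyj⟩ := mem_iUnion₂.1 hn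
  exact hm n (Finset.le_sup (f := fun j => m n (e n j)) (Finset.mem_Iic.2 hj))
    (hWV n (e n j) ⟨mem_iInter₂.1 hx j hj, hyj⟩)

/-- A space is Menger as soon as from every sequence of increasing open covers one can select one
member each so that the selected sets cover the space. -/
theorem isMenger_of_monotone {Z : Type u} [TopologicalSpace Z]
    (h : ∀ U : ℕ → ℕ → Set Z, (∀ n m, IsOpen (U n m)) → (∀ n, Monotone (U n)) →
      (∀ n z, ∃ m, z ∈ U n m) → ∃ g : ℕ → ℕ, ∀ z, ∃ n, z ∈ U n (g n)) : IsMenger Z := by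
  intro 𝒰 h𝒰
  rcases isEmpty_or_nonempty Z with hE | hE
  · refine ⟨fun _ => ∅, fun n => ⟨empty_subset _, finite_empty⟩, ?_⟩
    simp only [iUnion_empty]
    exact ⟨countable_empty, by simp, Subsingleton.elim _ _, by simp⟩
  have henum : ∀ n, ∃ e : ℕ → Set Z, 𝒰 n = range e := fun n => by
    refine (h𝒰 n).1.exists_eq_range ?_
    obtain ⟨A, hA, -⟩ := (h𝒰 n).2.2.1 ▸ mem_univ hE.some
    exact ⟨A, hA⟩
  choose e he using henum
  obtain ⟨g, hg⟩ := h (fun n m => ⋃ j ∈ Iic m, e n j)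
    (fun n m => isOpen_biUnion fun j _ => (h𝒰 n).2.1 _ (he n ▸ mem_range_self j))
    (fun n a b hab => biUnion_subset_biUnion_left (Iic_subset_Iic.2 hab))
    (fun n z => by
      obtain ⟨A, hA, hz⟩ := (h𝒰 n).2.2.1 ▸ mem_univ z
      rw [he n] at hA
      obtain ⟨j, rfl⟩ := hA
      exact ⟨j, mem_biUnion (mem_Iic.2 le_rfl) hz⟩)
  have hsub : ∀ n, e n '' Iic (g n) ⊆ 𝒰 n := fun n => he n ▸ image_subset_range _ _
  refine ⟨fun n => e n '' Iic (g n), fun n => ⟨hsub n, (finite_Iic _).image _⟩,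
    countable_iUnion fun n => (h𝒰 n).1.mono (hsub n), ?_, ?_, ?_⟩
  · intro A hA
    obtain ⟨n, hn⟩ := mem_iUnion.1 hA
    exact (h𝒰 n).2.1 A (hsub n hn)
  · refine eq_univ_of_forall fun z => ?_
    obtain ⟨n, hn⟩ := hg z
    obtain ⟨j, hj, hz⟩ := mem_iUnion₂.1 hn
    exact ⟨_, mem_iUnion.2 ⟨n, mem_image_of_mem _ hj⟩, hz⟩
  · intro hu
    obtain ⟨n, hn⟩ := mem_iUnion.1 hu
    exact (h𝒰 n).2.2.2 (hsub n hn)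

/-! ### Cardinal facts about 𝔡 -/

/-- A type of infinite cardinality `c` is the union of `cf c` many sets of smaller cardinality. -/
theorem exists_cover_mk_lt (α : Type u) (hα : ℵ₀ ≤ #α) :
    ∃ (I : Type u) (A : I → Set α), #I = (#α).ord.cof ∧ (∀ i, #(A i) < #α) ∧
      (⋃ i, A i) = univ := by
  obtain ⟨S, hS, hScard⟩ := Order.exists_cof_eq (#α).ord.ToType
  obtain ⟨e⟩ := Cardinal.eq.1 (Cardinal.mk_ord_toType #α)
  refine ⟨S, fun s => e '' Iic s.1, by rw [hScard, Ordinal.cof_toType], fun s => ?_, ?_⟩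
  · rw [Cardinal.mk_image_eq e.injective]
    conv_rhs => rw [← Cardinal.mk_ord_toType #α]
    exact Cardinal.mk_Iic_lt _ (by simp) (by simpa using hα)
  · refine eq_univ_of_forall fun x => ?_
    obtain ⟨s, hs, hxs⟩ := hS (e.symm x)
    exact mem_iUnion.2 ⟨⟨s, hs⟩, e.symm x, hxs, e.apply_symm_apply x⟩

theorem exists_eventually_dominating (s : ℕ → ℕ → ℕ) :
    ∃ h : ℕ → ℕ, ∀ k, ∀ᶠ n in atTop, s k n ≤ h n := by
  refine ⟨fun n => (Finset.Iic n).sup fun k => s k n, fun k => ?_⟩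
  filter_upwards [eventually_ge_atTop k] with n hn
  exact Finset.le_sup (f := fun k => s k n) (Finset.mem_Iic.2 hn)

theorem exists_dominating : ∃ D : Set (ℕ → ℕ), #D = dominatingNumber ∧
    ∀ f : ℕ → ℕ, ∃ g ∈ D, ∀ᶠ n in atTop, f n ≤ g n :=
  csInf_mem (s := {κ | ∃ D : Set (ℕ → ℕ), #D = κ ∧
    ∀ f : ℕ → ℕ, ∃ g ∈ D, ∀ᶠ n in atTop, f n ≤ g n})
    ⟨_, univ, rfl, fun f => ⟨f, mem_univ f, Eventually.of_forall fun _ => le_rfl⟩⟩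

theorem dominatingNumber_le {D : Set (ℕ → ℕ)}
    (hD : ∀ f : ℕ → ℕ, ∃ g ∈ D, ∀ᶠ n in atTop, f n ≤ g n) : dominatingNumber ≤ #D :=
  csInf_le' ⟨D, rfl, hD⟩

theorem exists_frequently_lt {ι : Type u} (hι : #ι < Cardinal.lift.{u} dominatingNumber)
    (s : ι → ℕ → ℕ) : ∃ g : ℕ → ℕ, ∀ i, ∃ᶠ n in atTop, s i n < g n := by
  by_contra! h
  refine hι.not_ge ?_
  have h1 : dominatingNumber ≤ #(range s) := dominatingNumber_le fun f => by
    obtain ⟨i, hi⟩ := h f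
    refine ⟨s i, mem_range_self i, ?_⟩
    simpa [not_frequently] using hi
  calc Cardinal.lift.{u} dominatingNumber ≤ Cardinal.lift.{u} #(range s) := Cardinal.lift_le.2 h1
    _ ≤ Cardinal.lift.{0} #ι := Cardinal.mk_range_le_lift
    _ = #ι := Cardinal.lift_uzero _

theorem aleph0_lt_dominatingNumber : ℵ₀ < dominatingNumber := by
  by_contra! h
  obtain ⟨D, hDc, hD⟩ := exists_dominating
  have hc : D.Countable := Cardinal.le_aleph0_iff_set_countable.1 (hDc ▸ h)
  obtain ⟨d, hd, -⟩ := hD 0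
  obtain ⟨e, rfl⟩ := hc.exists_eq_range ⟨d, hd⟩
  obtain ⟨g, hg⟩ := exists_eventually_dominating e
  obtain ⟨_, ⟨k, rfl⟩, hk⟩ := hD (fun n => g n + 1)
  obtain ⟨n, h1, h2⟩ := ((hg k).and hk).exists
  omega

theorem aleph0_lt_lift_dominatingNumber : ℵ₀ < Cardinal.lift.{u} dominatingNumber := by
  simpa using aleph0_lt_dominatingNumber

/-- Otherwise a dominating family splits into countably many pieces of size below 𝔡, each failing to
dominate some `g i`. A single `b` eventually above all `g i` is then dominated by no member. -/
theorem aleph0_lt_cof_dominatingNumber :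
    ℵ₀ < (Cardinal.lift.{u} dominatingNumber).ord.cof := by
  by_contra! h
  obtain ⟨D, hDc, hD⟩ := exists_dominating
  have hα : #(ULift.{u} D) = Cardinal.lift.{u} dominatingNumber := by
    rw [Cardinal.mk_uLift, hDc]
  obtain ⟨I, A, hI, hA, hU⟩ := exists_cover_mk_lt (ULift.{u} D)
    (hα ▸ aleph0_lt_lift_dominatingNumber.le)
  rw [hα] at hI hA
  choose g hg using fun i => exists_frequently_lt (hA i) fun f => f.1.down.1
  have hIc : Countable I := Cardinal.mk_le_aleph0_iff.1 (hI ▸ h)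
  have hcov : ∀ f : ULift.{u} D, ∃ i, f ∈ A i := fun f => mem_iUnion.1 (hU ▸ mem_univ f)
  have hne : Nonempty I := by
    obtain ⟨f, hf, -⟩ := hD 0
    exact ⟨(hcov ⟨f, hf⟩).choose⟩
  obtain ⟨e, he⟩ := exists_surjective_nat I
  obtain ⟨b, hb⟩ := exists_eventually_dominating fun k => g (e k)
  obtain ⟨f, hf, hbf⟩ := hD b
  obtain ⟨i, hi⟩ := hcov ⟨f, hf⟩
  obtain ⟨k, rfl⟩ := he i
  obtain ⟨n, hn, h1, h2⟩ := ((hg (e k) ⟨_, hi⟩).and_eventually ((hb k).and hbf)).exists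
  simp only at hn
  omega

theorem sum_lt_of_lt_cof {ι : Type u} {c : Cardinal.{u}} (hι : #ι < c.ord.cof)
    {f : ι → Cardinal.{u}} (hc : ℵ₀ ≤ c) (hf : ∀ i, f i < c) : Cardinal.sum f < c :=
  (Cardinal.sum_le_mk_mul_iSup f).trans_lt (Cardinal.mul_lt_of_lt hc
    (hι.trans_le (Ordinal.cof_ord_le c)) (Cardinal.iSup_lt_of_lt_cof_ord hι hf))

theorem sum_lt_of_lt_of_le {ι : Type u} {c d : Cardinal.{u}} (hι : #ι < c)
    {f : ι → Cardinal.{u}} (hc : ℵ₀ ≤ c) (hd : d < c) (hf : ∀ i, f i ≤ d) :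
    Cardinal.sum f < c := by
  refine (Cardinal.sum_le_sum f (fun _ => d) hf).trans_lt ?_
  rw [Cardinal.sum_const']
  exact Cardinal.mul_lt_of_lt hc hι hd

/-! ### Lower bound -/

/-- A union of few concentrated spaces has Menger products with all Hurewicz spaces, provided that
the numbers of compact sets involved add up to less than the dominating number. -/
theorem productive_of_iUnion {lam : Cardinal.{u}} {X ι : Type u} [TopologicalSpace X]
    {A : ι → Set X} (hA : ∀ i, IsKConcentrated lam (A i)) (hU : (⋃ i, A i) = univ)
    (hι : #ι < Cardinal.lift.{u} dominatingNumber)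
    (hsum : ∀ c : ι × ℕ → Cardinal.{u}, (∀ p, c p < lam) →
      Cardinal.sum c < Cardinal.lift.{u} dominatingNumber) :
    Productive IsHurewicz IsMenger X := by
  intro Y _ hY
  refine isMenger_of_monotone fun U ho hm hc => ?_
  choose D hD hDU using hA
  choose K hK hKD using hD
  have hL : ∀ i n, IsCompact (Subtype.val '' accumulate (K i) n) := fun i n =>
    (isCompact_accumulate (hK i) n).image continuous_subtype_val
  choose f W hWo hLW hf using fun i => hY.exists_tubes ho hm hc (hL i)
  obtain ⟨g, hg⟩ := exists_frequently_lt hι f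
  -- A point in `O i k` for all `k` lies in `W i n` for arbitrarily late `n` at which `g` beats `f
  -- i`, late enough for any given `y`.
  set O : ι → ℕ → Set X := fun i k => ⋃ n ∈ {n | k ≤ n ∧ f i n < g n}, W i n
  have hOo : ∀ i k, IsOpen (O i k) := fun i k => isOpen_biUnion fun n _ => hWo i n
  have hDO : ∀ i k, D i ⊆ (Subtype.val : A i → X) ⁻¹' O i k := by
    intro i k x hx
    rw [← hKD i] at hx
    obtain ⟨j, hj⟩ := mem_iUnion.1 hx
    obtain ⟨n, hn, h1, h2⟩ := ((hg i).and_eventually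
      ((eventually_ge_atTop k).and (eventually_ge_atTop j))).exists
    exact mem_biUnion (show n ∈ {n | k ≤ n ∧ f i n < g n} from ⟨h1, hn⟩)
      (hLW i n ⟨x, mem_accumulate.2 ⟨j, h2, hj⟩, rfl⟩)
  choose S hScard hSc hSU using fun p : ι × ℕ =>
    hDU p.1 _ ((hOo p.1 p.2).preimage continuous_subtype_val) (hDO p.1 p.2)
  have hT : #(Σ p : ι × ℕ, S p) < Cardinal.lift.{u} dominatingNumber := by
    rw [Cardinal.mk_sigma]
    exact hsum _ hScard
  -- Each leftover compact set is used as a constant sequence.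
  choose f' W' _ hKW' hf' using fun t : Σ p : ι × ℕ, S p =>
    hY.exists_tubes ho hm hc (K := fun _ => Subtype.val '' t.2.1)
      fun _ => (hSc t.1 _ t.2.2).image continuous_subtype_val
  obtain ⟨g', hg'⟩ := exists_frequently_lt hT f'
  refine ⟨fun n => max (g n) (g' n), fun ⟨x, y⟩ => ?_⟩
  obtain ⟨i, hi⟩ := mem_iUnion.1 (hU ▸ mem_univ x)
  by_cases hx : ∀ k, x ∈ O i k
  · obtain ⟨k, hk⟩ := eventually_atTop.1 (hf i y)
    obtain ⟨n, ⟨hkn, hn⟩, hxn⟩ := mem_iUnion₂.1 (hx k)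
    exact ⟨n, hm n (hn.le.trans (le_max_left _ _)) (hk n hkn x hxn)⟩
  · push Not at hx
    obtain ⟨k, hk⟩ := hx
    have hxS : (⟨x, hi⟩ : A i) ∈ ⋃₀ S (i, k) := by
      rw [hSU]
      exact hk
    obtain ⟨C, hC, hxC⟩ := hxS
    let t : Σ p : ι × ℕ, S p := ⟨(i, k), C, hC⟩
    obtain ⟨n, hn, h1⟩ := ((hg' t).and_eventually (hf' t y)).exists
    exact ⟨n, hm n (hn.le.trans (le_max_right _ _)) (h1 x (hKW' t n ⟨_, hxC, rfl⟩))⟩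

/-! ### Upper bound -/

theorem isHurewicz_punit : IsHurewicz PUnit.{u + 1} := by
  refine ⟨inferInstance, fun 𝒰 h _ => ?_⟩
  obtain ⟨A, hA, hx⟩ := (h 0).2.2.1 ▸ mem_univ PUnit.unit
  refine ((h 0).2.2.2 ?_).elim
  rwa [← Subsingleton.eq_univ_of_nonempty (s := A) ⟨_, hx⟩]

/-- Adding every constant to each member of a dominating family absorbs the finitely many exceptions
without raising the cardinality. -/
theorem exists_dominating_forall : ∃ E : Set (ℕ → ℕ), #E = dominatingNumber ∧
    ∀ f : ℕ → ℕ, ∃ g ∈ E, ∀ n, f n ≤ g n := by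
  obtain ⟨D, hDc, hD⟩ := exists_dominating
  have hE : ∀ f : ℕ → ℕ, ∃ g ∈ range (fun p : D × ℕ => fun n => p.1.1 n + p.2),
      ∀ n, f n ≤ g n := by
    intro f
    obtain ⟨g, hg, hfg⟩ := hD f
    obtain ⟨N, hN⟩ := eventually_atTop.1 hfg
    refine ⟨_, ⟨(⟨g, hg⟩, (Finset.range N).sup f), rfl⟩, fun n => ?_⟩
    rcases lt_or_ge n N with h | h
    · exact (Finset.le_sup (Finset.mem_range.2 h)).trans (Nat.le_add_left _ _)
    · exact (hN n h).trans (Nat.le_add_right _ _)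
  refine ⟨_, le_antisymm ?_ (dominatingNumber_le fun f => ?_), hE⟩
  · refine Cardinal.mk_range_le.trans ?_
    rw [Cardinal.mk_prod, hDc]
    simp [Cardinal.mul_aleph0_eq aleph0_lt_dominatingNumber.le]
  · obtain ⟨g, hg, hfg⟩ := hE f
    exact ⟨g, hg, Eventually.of_forall hfg⟩

/-- There is a regular space of cardinality the dominating number whose product with a one-point
space is not Menger. -/
theorem exists_not_productive : ∃ (X : Type u) (_ : TopologicalSpace X),
    #X = Cardinal.lift.{u} dominatingNumber ∧ RegularSpace X ∧
      ¬ Productive IsHurewicz IsMenger X := by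
  obtain ⟨E, hEc, hE⟩ := exists_dominating_forall
  refine ⟨ULift.{u} E, inferInstance, by rw [Cardinal.mk_uLift, hEc],
    Homeomorph.ulift.isInducing.regularSpace, fun h => ?_⟩
  set V : ℕ → ℕ → Set (ULift.{u} E × PUnit.{u + 1}) := fun n m => {p | p.1.down.1 n ≤ m} with hV
  obtain ⟨F, hF, hFO⟩ := h PUnit isHurewicz_punit (fun n => range (V n)) fun n =>
    ⟨countable_range _, by
      rintro _ ⟨m, rfl⟩
      have hcont : Continuous fun p : ULift.{u} E × PUnit.{u + 1} => p.1.down.1 n :=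
        (continuous_apply n).comp (continuous_subtype_val.comp
          (continuous_uliftDown.comp continuous_fst))
      exact (isOpen_discrete (Iic m)).preimage hcont,
    eq_univ_of_forall fun p => ⟨_, ⟨p.1.down.1 n, rfl⟩, le_refl (p.1.down.1 n)⟩, by
      rintro ⟨m, hm⟩
      obtain ⟨g, hg, hmg⟩ := hE fun _ => m + 1
      have : ((⟨⟨g, hg⟩⟩, PUnit.unit) : ULift.{u} E × PUnit.{u + 1}) ∈ V n m := hm ▸ mem_univ _
      exact absurd ((hmg n).trans this) (Nat.not_succ_le_self m)⟩
  have hVm : ∀ n, Monotone (V n) := fun n a b hab p (hp : _ ≤ a) => hp.trans hab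
  choose b hb using fun n => exists_sUnion_subset_of_finite (hVm n) (hF n).1 (hF n).2
  -- The selected sets bound the `n`th coordinate by `b n`, so a member everywhere above `b + 1`
  -- escapes them all.
  obtain ⟨g, hg, hbg⟩ := hE fun n => b n + 1
  obtain ⟨A, hA, hgA⟩ := hFO.2.2.1 ▸ mem_univ ((⟨⟨g, hg⟩⟩, PUnit.unit) : ULift.{u} E × PUnit)
  obtain ⟨n, hn⟩ := mem_iUnion.1 hA
  have h1 : g n ≤ b n := hb n ⟨A, hn, hgA⟩
  exact absurd ((hbg n).trans h1) (Nat.not_succ_le_self _)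

theorem isKConcentrated_of_mk_lt {lam : Cardinal.{u}} {X : Type u} [TopologicalSpace X]
    (h : #X < lam) : IsKConcentrated lam X := by
  refine ⟨∅, isSigmaCompact_empty, fun U _ _ => ⟨(fun x => {x}) '' Uᶜ, ?_, ?_, ?_⟩⟩
  · exact (Cardinal.mk_image_le.trans (Cardinal.mk_set_le _)).trans_lt h
  · rintro _ ⟨x, -, rfl⟩
    exact isCompact_singleton
  · rw [sUnion_image]
    exact biUnion_of_singleton _

end Selection

open Selection in
theorem theorem4p4 :
    (∀ lam : Cardinal.{u}, lam.IsRegular → ℵ₀ < lam →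
      lam ≤ Cardinal.lift.{u} Selection.dominatingNumber →
      IsLeast (Selection.unionNumbers lam) (Cardinal.lift.{u} Selection.dominatingNumber)) ∧
    IsLeast (Selection.unionNumbers (Cardinal.lift.{u} Selection.dominatingNumber))
      (Cardinal.lift.{u} Selection.dominatingNumber).ord.cof := by
  have hd := aleph0_lt_lift_dominatingNumber.{u}
  have hcof := aleph0_lt_cof_dominatingNumber.{u}
  have lower : (Cardinal.lift.{u} dominatingNumber).ord.cof ∈
      lowerBounds (unionNumbers (Cardinal.lift.{u} dominatingNumber)) := by
    rintro κ ⟨X, _, ι, A, rfl, hA, hU, -, hX⟩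
    by_contra! hι
    refine hX (productive_of_iUnion hA hU (hι.trans_le (Ordinal.cof_ord_le _)) fun c hc =>
      sum_lt_of_lt_cof ?_ hd.le hc)
    simpa using Cardinal.mul_lt_of_lt hcof.le hι hcof
  obtain ⟨X, _, hXc, hXr, hX⟩ := exists_not_productive.{u}
  refine ⟨fun lam hreg hlam hle => ⟨?_, ?_⟩, ?_, lower⟩
  · refine ⟨X, _, X, fun x => {x}, hXc, fun x => isKConcentrated_of_mk_lt ?_,
      iUnion_of_singleton X, hXr, hX⟩
    simpa using Cardinal.one_lt_aleph0.trans hlam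
  -- If `lam = 𝔡`, regularity gives cf 𝔡 = 𝔡 and the bound `lower` applies; if `lam < 𝔡`, then `lam`
  -- bounds all summands uniformly and cofinality is not needed.
  · rcases hle.eq_or_lt with rfl | hlt
    · have := hreg.cof_ord
      rwa [this] at lower
    rintro κ ⟨X, _, ι, A, rfl, hA, hU, -, hX⟩
    by_contra! hι
    refine hX (productive_of_iUnion hA hU hι fun c hc =>
      sum_lt_of_lt_of_le ?_ hd.le hlt fun p => (hc p).le)
    simpa using Cardinal.mul_lt_of_lt hd.le hι hd
  · obtain ⟨I, A, hI, hA, hU⟩ := exists_cover_mk_lt X (hXc ▸ hd.le)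
    rw [hXc] at hI hA
    exact ⟨X, _, I, A, hI, fun i => isKConcentrated_of_mk_lt (hA i), hU, hXr, hX⟩
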